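/- Let $K=\mathbb{F}_q$ be a finite field with $q$ elements ($q$ any prime power). Let $a=m/n$ and $b=s/r$ with integers $0<m<n$ and $0<s<r$, put $l:=\operatorname{lcm}(n,r)$, and assume $q\equiv 1\pmod l$. Let $z\in\mathbb{F}_q$ with $z\neq 0,1$, and let $\mathcal{C}_z^{(a,b)}\subset\mathbb{P}^2$ be the projective plane curve (possibly singular) which is the projective closure of the affine curve $$y^l=t^{\,l(1-b)}(1-t)^{\,lb}(1-zt)^{\,la},$$ that is, in homogeneous coordinates $[T:Y:W]$, $$Y^lW^{la}=T^{\,l(1-b)}(W-T)^{\,lb}(W-zT)^{\,la}.$$ For a finite field $F$ let multiplicative characters $\chi:F^\times\to\mathbb{C}^\times$ be extended by $\chi(0)=0$, let $\varepsilon$ be the trivial character (so $\varepsilon(0)=0$), and for characters $A,B,C$ of $F^\times$ and $x\in F$ put $${}_2F_1\left(\begin{matrix}A,&B\\&C\end{matrix}\,\Big|\,x\right):=\varepsilon(x)\,\frac{BC(-1)}{|F|}\sum_{y\in F}B(y)\,\overline{B}C(1-y)\,\overline{A}(1-xy).$$ Then for every integer $k\ge 1$ there is a character of order $l$ on $\mathbb{F}_{q^k}^\times$,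 and for every character $\eta_{q^k}$ of order $l$ on $\mathbb{F}_{q^k}^\times$ the number of $\mathbb{F}_{q^k}$-rational points of $\mathcal{C}_z^{(a,b)}$ is $$\#\mathcal{C}_z^{(a,b)}(\mathbb{F}_{q^k})=q^k+1+q^k\sum_{i=1}^{l-1}\eta_{q^k}^{\,ilb}(-1)\;{}_2F_1\left(\begin{matrix}\eta_{q^k}^{\,il(1-a)},&\eta_{q^k}^{\,il(1-b)}\\&\varepsilon\end{matrix}\,\Big|\,z\right),$$ where the hypergeometric functions are taken over $F=\mathbb{F}_{q^k}$. -/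

import Mathlib

open scoped LinearAlgebra.Projectivization

noncomputable section

namespace PlaneCurveCount

/-- For `n ∣ l`, the natural number `l · (m / n)`. -/
def scaled (l m n : ℕ) : ℕ := l / n * m

theorem cast_scaled {l m n : ℕ} (h : n ∣ l) (hn : 0 < n) :
    ((scaled l m n : ℕ) : ℚ) = l * ((m : ℚ) / n) := by
  have hn' : (n : ℚ) ≠ 0 := by exact_mod_cast hn.ne'
  rw [scaled, Nat.cast_mul, Nat.cast_div h hn']
  ring

theorem cast_scaled_sub {l m n : ℕ} (h : n ∣ l) (hn : 0 < n) (hm : m ≤ n) :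
    ((scaled l (n - m) n : ℕ) : ℚ) = l * (1 - (m : ℚ) / n) := by
  have hn' : (n : ℚ) ≠ 0 := by exact_mod_cast hn.ne'
  rw [cast_scaled h hn, Nat.cast_sub hm, sub_div, div_self hn']

/-- The finite-field hypergeometric function
`₂F₁(A, B; C | x) = ε(x) (BC(-1) / |F|) ∑_y B(y) (B̄C)(1 - y) Ā(1 - x y)`.
A `MulChar` takes the value `0` at `0`; the trivial character `ε` is `1 : MulChar F ℂ`. -/
def gaussHyp {F : Type*} [Field F] [Fintype F] (A B C : MulChar F ℂ) (x : F) : ℂ :=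
  (1 : MulChar F ℂ) x * ((B * C) (-1) / (Fintype.card F : ℂ)) *
    ∑ y : F, B y * (B⁻¹ * C) (1 - y) * A⁻¹ (1 - x * y)

/-- The form of degree `l + la`, `l = lcm n r`, `a = m / n`, `b = s / r`,
`Y ^ l W ^ (la) - T ^ (l(1-b)) (W - T) ^ (lb) (W - z T) ^ (la)`, where `T, Y, W` are the
coordinates `0, 1, 2`: the homogenization of
`y ^ l - t ^ (l(1-b)) (1 - t) ^ (lb) (1 - z t) ^ (la)`. -/
def curveForm {K : Type*} [Field K] (m n s r : ℕ) (z : K) : MvPolynomial (Fin 3) K :=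
  .X 1 ^ n.lcm r * .X 2 ^ scaled (n.lcm r) m n -
    .X 0 ^ scaled (n.lcm r) (r - s) r *
      (.X 2 - .X 0) ^ scaled (n.lcm r) s r *
      (.X 2 - .C z * .X 0) ^ scaled (n.lcm r) m n

theorem curveForm_isHomogeneous {K : Type*} [Field K] {m n s r : ℕ} (hs : s ≤ r) (z : K) :
    (curveForm m n s r z).IsHomogeneous (n.lcm r + scaled (n.lcm r) m n) := by
  have e : scaled (n.lcm r) (r - s) r + scaled (n.lcm r) s r = n.lcm r := by
    rw [scaled, scaled, ← mul_add, Nat.sub_add_cancel hs, Nat.div_mul_cancel (Nat.dvd_lcm_right n r)]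
  have hX : ∀ i : Fin 3, (MvPolynomial.X i : MvPolynomial (Fin 3) K).IsHomogeneous 1 :=
    MvPolynomial.isHomogeneous_X K
  have hz : (MvPolynomial.C z * MvPolynomial.X 0 : MvPolynomial (Fin 3) K).IsHomogeneous 1 := by
    simpa using (MvPolynomial.isHomogeneous_C (Fin 3) z).mul (hX 0)
  refine MvPolynomial.IsHomogeneous.sub ?_ ?_
  · simpa using ((hX 1).pow (n.lcm r)).mul ((hX 2).pow (scaled (n.lcm r) m n))
  · have := (((hX 0).pow (scaled (n.lcm r) (r - s) r)).mul
      (((hX 2).sub (hX 0)).pow (scaled (n.lcm r) s r))).mul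
      (((hX 2).sub hz).pow (scaled (n.lcm r) m n))
    simpa only [one_mul, e] using this

/-- On the chart `W = 1` the curve has the affine equation
`y ^ l = t ^ (l(1-b)) (1 - t) ^ (lb) (1 - z t) ^ (la)`. -/
theorem aeval_curveForm_affine {K L : Type*} [Field K] [Field L] [Algebra K L]
    (m n s r : ℕ) (z : K) (t y : L) :
    MvPolynomial.aeval ![t, y, 1] (curveForm m n s r z) = 0 ↔
      y ^ n.lcm r = t ^ scaled (n.lcm r) (r - s) r * (1 - t) ^ scaled (n.lcm r) s r *
        (1 - algebraMap K L z * t) ^ scaled (n.lcm r) m n := by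
  simp [curveForm, sub_eq_zero]

/-- The `L`-rational points in the projective plane of the zero locus of a form `G` over `K`. -/
def planePoints {K : Type*} [Field K] (G : MvPolynomial (Fin 3) K)
    (L : Type*) [Field L] [Algebra K L] : Set (ℙ L (Fin 3 → L)) :=
  {P | MvPolynomial.aeval P.rep G = 0}

/-- For a form, vanishing at a projective point can be tested on any representative. -/
theorem mk_mem_planePoints {K L : Type*} [Field K] [Field L] [Algebra K L]
    {G : MvPolynomial (Fin 3) K} {d : ℕ} (hG : G.IsHomogeneous d) (v : Fin 3 → L) (hv : v ≠ 0) :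
    Projectivization.mk L v hv ∈ planePoints G L ↔ MvPolynomial.aeval v G = 0 := by
  obtain ⟨c, hc⟩ := Projectivization.exists_smul_eq_mk_rep L v hv
  have key : MvPolynomial.aeval ((c : L) • v) G = (c : L) ^ d * MvPolynomial.aeval v G := by
    rw [MvPolynomial.aeval_def, MvPolynomial.aeval_def, MvPolynomial.eval₂_eq',
      MvPolynomial.eval₂_eq', Finset.mul_sum]
    refine Finset.sum_congr rfl fun e he => ?_
    have hd : ∑ i, e i = d := by
      have := hG (MvPolynomial.mem_support_iff.mp he)
      simpa [Finsupp.weight_apply, Finsupp.sum_fintype] using this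
    simp only [Pi.smul_apply, smul_eq_mul, mul_pow, Finset.prod_mul_distrib,
      Finset.prod_pow_eq_pow_sum, hd]
    ring
  have hc' : (Projectivization.mk L v hv).rep = (c : L) • v := by rw [← hc]; rfl
  simp only [planePoints, Set.mem_ofPred_eq, hc', key, mul_eq_zero, pow_eq_zero_iff',
    Units.ne_zero, false_and, false_or]

end PlaneCurveCount

end

open PlaneCurveCount

/-! Only points of the plane model are counted, so singularities play no role. In the chart `W = 1`,
count the roots `y` of `y ^ l = f t` for each `t`. Orthogonality on the cyclic group `Fˣ / (Fˣ) ^ l`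
gives `1 + ∑ χ ^ i (f t)` over `0 < i < l`, which is also right when `f t = 0`; summing over `t`
gives `q ^ k` plus character sums. Multiplicativity turns `χ ^ i (f t)` into the summand of a `₂F₁`,
whose factor `1 / |F|` is undone by `q ^ k` and whose sign is undone by `η ^ (i l b) (-1)`. The
single point at infinity supplies the remaining `1`. -/

/-- If `χ` is a character of order `l` of a finite field `F`, the values at `u ≠ 0` of the powers
of `χ` sum to the number of `l`-th roots of `u`. -/
theorem sum_pow_apply_eq_card_roots {F : Type*} [Field F] [Fintype F] [DecidableEq F]
    (χ : MulChar F ℂ) {u : F} (hu : u ≠ 0) :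
    ∑ i ∈ Finset.range (orderOf χ), (χ ^ i) u =
      ((Finset.univ.filter fun y : F => y ^ orderOf χ = u).card : ℂ) := by
  set l := orderOf χ with hl
  have hl0 : 0 < l := χ.orderOf_pos
  lift u to Fˣ using isUnit_iff_ne_zero.mpr hu
  obtain ⟨g, hg⟩ := IsCyclic.exists_generator (α := Fˣ)
  have hlN : l ∣ Fintype.card F - 1 := χ.orderOf_dvd_card_sub_one
  simp only [MulChar.pow_apply_coe]
  have hpow : ∀ a : Fˣ, χ a ^ l = 1 := fun a => by
    rw [← MulChar.pow_apply_coe, hl, pow_orderOf_eq_one, MulChar.one_apply_coe]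
  by_cases h : ∃ α : F, α ^ l = u
  · obtain ⟨d, hd⟩ := hlN
    have hN : orderOf g = Fintype.card F - 1 := by
      rw [orderOf_eq_card_of_forall_mem_zpowers hg, Nat.card_eq_fintype_card, Fintype.card_units]
    -- `F` contains all `l`-th roots of unity, so an `l`-th power `u ≠ 0` has exactly `l` roots.
    have hprim : IsPrimitiveRoot ((g : F) ^ d) l := by
      refine IsPrimitiveRoot.pow (n := Fintype.card F - 1) ?_ ?_ (by rw [hd, mul_comm])
      · have := Fintype.one_lt_card (α := F)
        omega
      · rw [← hN]
        exact IsPrimitiveRoot.coe_units_iff.mpr (IsPrimitiveRoot.orderOf g)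
    have hcard : (Finset.univ.filter fun y : F => y ^ l = u).card = l := by
      have h1 := hprim.card_nthRoots (u : F)
      rw [if_pos h, ← Multiset.toFinset_card_of_nodup (hprim.nthRoots_nodup hu)] at h1
      refine Eq.trans (congrArg Finset.card ?_) h1
      ext y
      simp [Polynomial.mem_nthRoots hl0]
    obtain ⟨α, hα⟩ := h
    have hα0 : α ≠ 0 := by
      rintro rfl
      exact hu (by rw [← hα, zero_pow hl0.ne'])
    lift α to Fˣ using isUnit_iff_ne_zero.mpr hα0
    have h1 : χ (u : F) = 1 := by rw [← hα, map_pow, hpow]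
    simp [hcard, h1]
  · have h0 : (Finset.univ.filter fun y : F => y ^ l = u) = ∅ := by
      ext y
      simpa using fun hy => h ⟨y, hy⟩
    rw [h0, Finset.card_empty, Nat.cast_zero]
    -- A character is determined by its value at the generator `g`: if `u = g ^ j` and `χ u = 1`,
    -- then `χ ^ j = 1`, so `l ∣ j` and `u` would be an `l`-th power.
    have h1 : χ (u : F) ≠ 1 := by
      intro h1
      obtain ⟨j, hj⟩ := (isOfFinOrder_of_finite g).mem_powers_iff_mem_zpowers.mpr (hg u)
      have hj' : g ^ j = u := hj
      have h2 : χ ^ j = 1 := by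
        rw [MulChar.eq_iff hg, MulChar.pow_apply_coe, MulChar.one_apply_coe, ← map_pow,
          ← Units.val_pow_eq_pow_val, hj', h1]
      obtain ⟨c, hc⟩ := orderOf_dvd_of_pow_eq_one h2
      exact h ⟨(g ^ c : Fˣ), by
        rw [← Units.val_pow_eq_pow_val, ← pow_mul, mul_comm, hl, ← hc, hj']⟩
    have h2 := mul_neg_geom_sum (χ (u : F)) l
    rw [hpow, sub_self] at h2
    exact (mul_eq_zero.mp h2).resolve_left (sub_ne_zero.mpr h1.symm)

/-- The number of affine points of `y ^ l = f t` over a finite field, `l` being the order of `χ`,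
in terms of the character sums of `f`. -/
theorem card_superelliptic {F : Type*} [Field F] [Fintype F] [DecidableEq F]
    (χ : MulChar F ℂ) (f : F → F) :
    ((Finset.univ.filter fun p : F × F => p.2 ^ orderOf χ = f p.1).card : ℂ) =
      Fintype.card F + ∑ i ∈ Finset.Icc 1 (orderOf χ - 1), ∑ t : F, (χ ^ i) (f t) := by
  have hl0 : 0 < orderOf χ := χ.orderOf_pos
  have hsum : ∀ h : ℕ → ℂ, ∑ i ∈ Finset.range (orderOf χ), h i =
      h 0 + ∑ i ∈ Finset.Icc 1 (orderOf χ - 1), h i := fun h => by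
    have e : Finset.Icc 1 (orderOf χ - 1) = Finset.Ico 1 (orderOf χ) := by
      ext i
      simp only [Finset.mem_Icc, Finset.mem_Ico]
      omega
    rw [e, Finset.range_eq_Ico, Finset.sum_eq_sum_Ico_succ_bot hl0]
  have hfib : ∀ t : F, ((Finset.univ.filter fun y : F => y ^ orderOf χ = f t).card : ℂ) =
      1 + ∑ i ∈ Finset.Icc 1 (orderOf χ - 1), (χ ^ i) (f t) := fun t => by
    -- Over a zero of `f` the only root is `y = 0`. The `1` cannot be written as `ε (f t)`, since `ε
    -- 0 = 0`.
    by_cases ht : f t = 0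
    · simp [ht, hl0.ne', MulChar.map_zero, Finset.filter_eq']
    · rw [← sum_pow_apply_eq_card_roots χ ht, hsum, pow_zero,
        MulChar.one_apply (isUnit_iff_ne_zero.mpr ht)]
  have hcard : (Finset.univ.filter fun p : F × F => p.2 ^ orderOf χ = f p.1).card =
      ∑ t : F, (Finset.univ.filter fun y : F => y ^ orderOf χ = f t).card := by
    simp only [Finset.card_filter, Fintype.sum_prod_type]
  rw [hcard, Nat.cast_sum, Finset.sum_congr rfl fun t _ => hfib t, Finset.sum_add_distrib,
    Finset.sum_comm]
  simp

/-- The curve has one point at infinity, `[0 : 1 : 0]`. -/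
theorem ncard_planePoints_curveForm {K L : Type*} [Field K] [Field L] [Fintype L] [DecidableEq L]
    [Algebra K L] {m n s r : ℕ} (hsr : s < r)
    (hm : 0 < scaled (n.lcm r) m n) {z : K} (hz0 : z ≠ 0) :
    (planePoints (curveForm m n s r z) L).ncard =
      (Finset.univ.filter fun p : L × L => p.2 ^ n.lcm r =
        p.1 ^ scaled (n.lcm r) (r - s) r * (1 - p.1) ^ scaled (n.lcm r) s r *
          (1 - algebraMap K L z * p.1) ^ scaled (n.lcm r) m n).card + 1 := by
  classical
  have hv : ∀ p : L × L, (![p.1, p.2, 1] : Fin 3 → L) ≠ 0 := fun p h =>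
    one_ne_zero (congrFun h 2)
  have hinf : (![0, 1, 0] : Fin 3 → L) ≠ 0 := fun h => one_ne_zero (congrFun h 1)
  have hz : algebraMap K L z ≠ 0 := by simpa using hz0
  have hform := curveForm_isHomogeneous (n := n) (m := m) hsr.le z
  have e : scaled (n.lcm r) (r - s) r + scaled (n.lcm r) s r = n.lcm r := by
    rw [scaled, scaled, ← mul_add, Nat.sub_add_cancel hsr.le,
      Nat.div_mul_cancel (Nat.dvd_lcm_right n r)]
  set S := Finset.univ.filter fun p : L × L => p.2 ^ n.lcm r =
        p.1 ^ scaled (n.lcm r) (r - s) r * (1 - p.1) ^ scaled (n.lcm r) s r *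
          (1 - algebraMap K L z * p.1) ^ scaled (n.lcm r) m n with hS
  let φ : L × L → ℙ L (Fin 3 → L) := fun p => Projectivization.mk L _ (hv p)
  have hφ : Function.Injective φ := by
    intro p p' h
    obtain ⟨c, hc⟩ := (Projectivization.mk_eq_mk_iff' L _ _ (hv p) (hv p')).mp h
    have h2 := congrFun hc 2
    have h0 := congrFun hc 0
    have h1 := congrFun hc 1
    simp only [Pi.smul_apply, smul_eq_mul, Matrix.cons_val] at h0 h1 h2
    rw [mul_one] at h2
    subst h2
    exact Prod.ext (by simpa using h0.symm) (by simpa using h1.symm)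
  have hset : planePoints (curveForm m n s r z) L =
      ↑(insert (Projectivization.mk L _ hinf) (S.image φ)) := by
    ext P
    induction P using Projectivization.ind with
    | h v hv0 =>
    rw [mk_mem_planePoints hform, Finset.mem_coe, Finset.mem_insert, Finset.mem_image]
    by_cases h2 : v 2 = 0
    · have hna : ¬ ∃ p ∈ S, φ p = Projectivization.mk L v hv0 := by
        rintro ⟨p, -, hp⟩
        obtain ⟨c, hc⟩ := (Projectivization.mk_eq_mk_iff' L _ _ (hv p) hv0).mp hp
        have := congrFun hc 2
        simp [h2] at this
      rw [or_iff_left hna, Projectivization.mk_eq_mk_iff']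
      -- On `W = 0` the first monomial dies because `la > 0`, leaving a multiple of a power of `T`
      -- that is nonzero since `z ≠ 0`.
      have heval : MvPolynomial.aeval v (curveForm m n s r z) = 0 ↔ v 0 = 0 := by
        simp only [curveForm, map_sub, map_mul, map_pow, MvPolynomial.aeval_X,
          MvPolynomial.aeval_C, h2, zero_pow hm.ne', mul_zero, zero_sub, neg_eq_zero,
          mul_eq_zero, pow_eq_zero_iff', hz, false_or, hm.ne', ne_eq, not_false_eq_true, and_true]
        constructor
        · rintro ((h | h) | h)
          exacts [h.1, h.1, h]
        · exact Or.inr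
      rw [heval]
      constructor
      · intro h0
        refine ⟨v 1, ?_⟩
        ext i
        fin_cases i <;> simp [h0, h2]
      · rintro ⟨c, hc⟩
        simpa using (congrFun hc 0).symm
    · have hni : Projectivization.mk L v hv0 ≠ Projectivization.mk L _ hinf := by
        intro h
        obtain ⟨c, hc⟩ := (Projectivization.mk_eq_mk_iff' L _ _ hv0 hinf).mp h
        exact h2 (by simpa using (congrFun hc 2).symm)
      rw [or_iff_right hni]
      have hP : φ (v 0 / v 2, v 1 / v 2) = Projectivization.mk L v hv0 := by
        refine (Projectivization.mk_eq_mk_iff' L _ _ _ _).mpr ⟨(v 2)⁻¹, ?_⟩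
        ext i
        fin_cases i <;> simp [h2, div_eq_inv_mul]
      rw [← mk_mem_planePoints hform v hv0, ← hP, mk_mem_planePoints hform,
        aeval_curveForm_affine]
      constructor
      · exact fun h => ⟨_, by simpa [hS] using h, rfl⟩
      · rintro ⟨p, hp, hpe⟩
        rw [hφ hpe] at hp
        simpa [hS] using hp
  rw [hset, Set.ncard_coe_finset, Finset.card_insert_of_notMem, Finset.card_image_of_injective _ hφ]
  rw [Finset.mem_image]
  rintro ⟨p, -, hp⟩
  obtain ⟨c, hc⟩ := (Projectivization.mk_eq_mk_iff' L _ _ (hv p) hinf).mp hp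
  simpa using congrFun hc 2

/-- The character sums of the curve are hypergeometric values. -/
theorem sum_pow_apply_eq_gaussHyp {F : Type*} [Field F] [Fintype F] (χ : MulChar F ℂ) (i : ℕ)
    {A A' B B' : ℕ} (hA : A' + A = orderOf χ) (hB : B' + B = orderOf χ)
    (hA0 : A ≠ 0) (hB0 : B ≠ 0) (hB0' : B' ≠ 0) {x : F} (hx : x ≠ 0) :
    ∑ t : F, (χ ^ i) (t ^ B' * (1 - t) ^ B * (1 - x * t) ^ A) =
      Fintype.card F * ((χ ^ (i * B)) (-1) * gaussHyp (χ ^ (i * A')) (χ ^ (i * B')) 1 x) := by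
  -- Exponents adding up to `l` give mutually inverse characters; this matches `l(1-a)` with `la`
  -- and `l(1-b)` with `lb`.
  have hmul : ∀ {C C' : ℕ}, C' + C = orderOf χ → χ ^ (i * C') * χ ^ (i * C) = 1 := fun h => by
    rw [← pow_add, ← mul_add, h, mul_comm, pow_mul, pow_orderOf_eq_one, one_pow]
  have hneg : (χ ^ (i * B)) (-1) * (χ ^ (i * B')) (-1) = 1 := by
    rw [mul_comm, ← MulChar.mul_apply, hmul hB, MulChar.one_apply isUnit_one.neg]
  have hcard : (Fintype.card F : ℂ) ≠ 0 := Nat.cast_ne_zero.mpr Fintype.card_ne_zero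
  rw [gaussHyp, inv_eq_of_mul_eq_one_right (hmul hA), inv_eq_of_mul_eq_one_right (hmul hB),
    mul_one, mul_one, MulChar.one_apply (isUnit_iff_ne_zero.mpr hx), one_mul]
  -- The exponents must be positive: where a factor vanishes, `0 ^ 0 = 1` would disagree with `ε 0 =
  -- 0`.
  have hterm : ∀ t : F, (χ ^ i) (t ^ B' * (1 - t) ^ B * (1 - x * t) ^ A) =
      (χ ^ (i * B')) t * (χ ^ (i * B)) (1 - t) * (χ ^ (i * A)) (1 - x * t) := fun t => by
    rw [map_mul, map_mul, map_pow, map_pow, map_pow, pow_mul, pow_mul, pow_mul,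
      MulChar.pow_apply' _ hB0', MulChar.pow_apply' _ hB0, MulChar.pow_apply' _ hA0]
  rw [Finset.sum_congr rfl fun t _ => hterm t]
  generalize ∑ t : F, (χ ^ (i * B')) t * (χ ^ (i * B)) (1 - t) * (χ ^ (i * A)) (1 - x * t) = S
  field_simp
  rw [mul_assoc, hneg, mul_one]

theorem mainTheorem4 {K L : Type*} [Field K] [Fintype K] [Field L] [Fintype L] [Algebra K L]
    (q k : ℕ) (hq : Fintype.card K = q) (hk : Module.finrank K L = k)
    (m n s r : ℕ) (hm : 0 < m) (hmn : m < n) (hs : 0 < s) (hsr : s < r)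
    (hl : q ≡ 1 [MOD n.lcm r]) (z : K) (hz0 : z ≠ 0) (hz1 : z ≠ 1) :
    (∃ η : MulChar L ℂ, orderOf η = n.lcm r) ∧
    ∀ η : MulChar L ℂ, orderOf η = n.lcm r →
      ((planePoints (curveForm m n s r z) L).ncard : ℂ) =
        (q : ℂ) ^ k + 1 + (q : ℂ) ^ k *
          ∑ i ∈ Finset.Icc 1 (n.lcm r - 1),
            (η ^ (i * scaled (n.lcm r) s r)) (-1) *
              gaussHyp (η ^ (i * scaled (n.lcm r) (n - m) n))
                (η ^ (i * scaled (n.lcm r) (r - s) r)) 1 (algebraMap K L z) := by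
  classical
  have hn : 0 < n := hm.trans hmn
  have hr : 0 < r := hs.trans hsr
  have hl0 : 0 < n.lcm r := Nat.lcm_pos hn hr
  have hdn := Nat.div_pos (Nat.le_of_dvd hl0 (Nat.dvd_lcm_left n r)) hn
  have hdr := Nat.div_pos (Nat.le_of_dvd hl0 (Nat.dvd_lcm_right n r)) hr
  have hA : scaled (n.lcm r) (n - m) n + scaled (n.lcm r) m n = n.lcm r := by
    rw [scaled, scaled, ← mul_add, Nat.sub_add_cancel hmn.le,
      Nat.div_mul_cancel (Nat.dvd_lcm_left n r)]
  have hB : scaled (n.lcm r) (r - s) r + scaled (n.lcm r) s r = n.lcm r := by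
    rw [scaled, scaled, ← mul_add, Nat.sub_add_cancel hsr.le,
      Nat.div_mul_cancel (Nat.dvd_lcm_right n r)]
  have hA0 : 0 < scaled (n.lcm r) m n := Nat.mul_pos hdn hm
  have hB0 : 0 < scaled (n.lcm r) s r := Nat.mul_pos hdr hs
  have hB0' : 0 < scaled (n.lcm r) (r - s) r := Nat.mul_pos hdr (Nat.sub_pos_of_lt hsr)
  have hcard : Fintype.card L = q ^ k := by
    rw [Module.card_eq_pow_finrank (K := K), hq, hk]
  have hz : algebraMap K L z ≠ 0 := by simpa using hz0
  constructor
  · refine MulChar.exists_mulChar_orderOf L ?_ (Complex.isPrimitiveRoot_exp _ hl0.ne')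
    -- A character of order `l` exists because `l` divides `q ^ k - 1`, the order of the cyclic
    -- group `Lˣ`.
    have h1 : 1 ≡ Fintype.card L [MOD n.lcm r] := by
      rw [hcard]
      simpa using (hl.pow k).symm
    exact (Nat.modEq_iff_dvd' Fintype.card_pos).mp h1
  · intro η hη
    have haff := card_superelliptic η fun t : L => t ^ scaled (n.lcm r) (r - s) r *
      (1 - t) ^ scaled (n.lcm r) s r * (1 - algebraMap K L z * t) ^ scaled (n.lcm r) m n
    rw [Finset.sum_congr rfl fun i _ => sum_pow_apply_eq_gaussHyp η i (hA.trans hη.symm)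
      (hB.trans hη.symm) hA0.ne' hB0.ne' hB0'.ne' hz, ← Finset.mul_sum, hη] at haff
    rw [ncard_planePoints_curveForm hsr hA0 hz0, Nat.cast_add, haff, hcard]
    push_cast
    ring
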